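/- Let $N\ge 1$, let $\Omega\subset\mathbb{R}^N$ be a nonempty open bounded connected set, and let $1<q<2$, $\alpha>0$. Let $W^{1,2}_0(\Omega)$ be the closure of $C^\infty_0(\Omega)$ with respect to the norm $\|\varphi\|_{L^2(\Omega)}+\|\nabla\varphi\|_{L^2(\Omega)}$, and for $\varphi\in W^{1,2}_0(\Omega)$ set \[ \mathfrak{F}_{q,\alpha}(\varphi)=\frac12\int_\Omega|\nabla\varphi|^2\,dx-\frac{\alpha}{q}\int_\Omega|\varphi|^q\,dx . \] Let $w$ be the positive minimizer of $\mathfrak{F}_{q,\alpha}$ over $W^{1,2}_0(\Omega)$, and put \[ \Gamma=\big\{\gamma\in C([0,1];W^{1,2}_0(\Omega)) : \gamma(0)=w,\ \gamma(1)=-w\big\},\qquad \Lambda^*=\inf_{\gamma\in\Gamma}\ \max_{\varphi\in\mathrm{Im}(\gamma)}\mathfrak{F}_{q,\alpha}(\varphi). \] Let $\widetilde\Gamma^1_\infty$ be the set of all $\gamma\in C([0,+\infty);L^1(\Omega))$ such that $\mathrm{Im}(\gamma)\subset W^{1,2}_0(\Omega)$, $\gamma(0)=w$ and $\lim_{t\to+\infty}\|\gamma(t)-(-w)\|_{L^1(\Omega)}=0$,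 and put \[ \nu^*_\infty=\inf_{\gamma\in\widetilde\Gamma^1_\infty}\ \sup_{\varphi\in\mathrm{Im}(\gamma)}\mathfrak{F}_{q,\alpha}(\varphi), \] where the supremum may be $+\infty$. Then \[ \nu^*_\infty=\Lambda^* . \] -/

import Mathlib

open MeasureTheory Set Filter Topology
open scoped NNReal ENNReal ContDiff

noncomputable section

namespace MountainPass

/-- `C^∞_0(Ω)`: smooth functions with compact support contained in `Ω`. -/
def IsTestFunction {N : ℕ} (Ω : Set (EuclideanSpace ℝ (Fin N)))
    (f : EuclideanSpace ℝ (Fin N) → ℝ) : Prop :=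
  ContDiff ℝ ∞ f ∧ HasCompactSupport f ∧ tsupport f ⊆ Ω

/-- The pairs `(f, ∇f)`, `f ∈ C^∞_0(Ω)`, inside `L²(Ω) × L²(Ω; ℝ^N)`. -/
def testGraph {N : ℕ} (Ω : Set (EuclideanSpace ℝ (Fin N))) :
    Submodule ℝ (Lp ℝ 2 (volume.restrict Ω) ×
      Lp (EuclideanSpace ℝ (Fin N)) 2 (volume.restrict Ω)) where
  carrier := {p | ∃ f : EuclideanSpace ℝ (Fin N) → ℝ, IsTestFunction Ω f ∧
    p.1 =ᵐ[volume.restrict Ω] f ∧ p.2 =ᵐ[volume.restrict Ω] gradient f}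
  zero_mem' := by
    refine ⟨0, ⟨contDiff_const, HasCompactSupport.zero, by simp⟩, Lp.coeFn_zero _ _ _, ?_⟩
    have h0 : gradient (0 : EuclideanSpace ℝ (Fin N) → ℝ) = 0 := by
      ext1 x
      exact gradient_fun_const x 0
    rw [h0]
    exact Lp.coeFn_zero _ _ _
  add_mem' := by
    rintro p r ⟨f, ⟨hf1, hf2, hf3⟩, hf4, hf5⟩ ⟨g, ⟨hg1, hg2, hg3⟩, hg4, hg5⟩
    refine ⟨f + g, ⟨hf1.add hg1, hf2.add hg2,
      (tsupport_add f g).trans (union_subset hf3 hg3)⟩, ?_, ?_⟩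
    · filter_upwards [Lp.coeFn_add p.1 r.1, hf4, hg4] with x h1 h2 h3
      rw [Prod.fst_add, h1, Pi.add_apply, Pi.add_apply, h2, h3]
    · filter_upwards [Lp.coeFn_add p.2 r.2, hf5, hg5] with x h1 h2 h3
      rw [Prod.snd_add, h1, Pi.add_apply, h2, h3]
      have hf : DifferentiableAt ℝ f x := hf1.differentiable (by simp) x
      have hg : DifferentiableAt ℝ g x := hg1.differentiable (by simp) x
      simp only [gradient, fderiv_add hf hg, map_add]
  smul_mem' := by
    rintro c p ⟨f, ⟨hf1, hf2, hf3⟩, hf4, hf5⟩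
    refine ⟨c • f, ⟨contDiff_const.smul hf1, hf2.smul_left (f := fun _ => c),
      (tsupport_smul_subset_right (fun _ => c) f).trans hf3⟩, ?_, ?_⟩
    · filter_upwards [Lp.coeFn_smul c p.1, hf4] with x h1 h2
      rw [Prod.smul_fst, h1, Pi.smul_apply, Pi.smul_apply, h2]
    · filter_upwards [Lp.coeFn_smul c p.2, hf5] with x h1 h2
      rw [Prod.smul_snd, h1, Pi.smul_apply, h2]
      have hf : DifferentiableAt ℝ f x := hf1.differentiable (by simp) x
      simp only [gradient, fderiv_const_smul hf c, map_smul]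

/-- `W^{1,2}_0(Ω)`: the closure of `C^∞_0(Ω)` in the norm `‖φ‖_{L²} + ‖∇φ‖_{L²}`, realised as the
space of pairs `(φ, ∇φ)` of a function and its weak gradient. As a subspace of
`L²(Ω) × L²(Ω; ℝ^N)` it carries the topology of that norm. -/
abbrev W0 {N : ℕ} (Ω : Set (EuclideanSpace ℝ (Fin N))) :
    Submodule ℝ (Lp ℝ 2 (volume.restrict Ω) ×
      Lp (EuclideanSpace ℝ (Fin N)) 2 (volume.restrict Ω)) :=
  (testGraph Ω).topologicalClosure

/-- The function underlying an element of `W^{1,2}_0(Ω)`. -/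
def W0.val {N : ℕ} {Ω : Set (EuclideanSpace ℝ (Fin N))} (φ : W0 Ω) :
    EuclideanSpace ℝ (Fin N) → ℝ :=
  φ.1.1

/-- The weak gradient of an element of `W^{1,2}_0(Ω)`. -/
def W0.grad {N : ℕ} {Ω : Set (EuclideanSpace ℝ (Fin N))} (φ : W0 Ω) :
    EuclideanSpace ℝ (Fin N) → EuclideanSpace ℝ (Fin N) :=
  φ.1.2

/-- The energy `𝔉_{q,α}(φ) = ½ ∫_Ω |∇φ|² dx - (α/q) ∫_Ω |φ|^q dx`. -/
def energy {N : ℕ} {Ω : Set (EuclideanSpace ℝ (Fin N))} (q α : ℝ) (φ : W0 Ω) : ℝ :=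
  (1 / 2) * (∫ x in Ω, ‖W0.grad φ x‖ ^ 2) - (α / q) * ∫ x in Ω, |W0.val φ x| ^ q

/-- `w` is a positive minimizer of the energy over `W^{1,2}_0(Ω)`. -/
def IsPositiveMinimizer {N : ℕ} {Ω : Set (EuclideanSpace ℝ (Fin N))} (q α : ℝ) (w : W0 Ω) :
    Prop :=
  (∀ φ : W0 Ω, energy q α w ≤ energy q α φ) ∧ ∀ᵐ x ∂(volume.restrict Ω), 0 < W0.val w x

/-- `Γ`: paths from `w` to `-w` in `C([0,1]; W^{1,2}_0(Ω))`. -/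
def strongPaths {N : ℕ} {Ω : Set (EuclideanSpace ℝ (Fin N))} (w : W0 Ω) :
    Set (C(unitInterval, W0 Ω)) :=
  {γ | γ 0 = w ∧ γ 1 = -w}

/-- The mountain pass level `Λ^*`. -/
def mountainPassLevel {N : ℕ} {Ω : Set (EuclideanSpace ℝ (Fin N))} (q α : ℝ) (w : W0 Ω) : EReal :=
  ⨅ γ ∈ strongPaths w, ⨆ φ ∈ range γ, (energy q α φ : EReal)

/-- Distance of two elements of `W^{1,2}_0(Ω)` in `L¹(Ω)`. -/
def l1Dist {N : ℕ} {Ω : Set (EuclideanSpace ℝ (Fin N))} (φ ψ : W0 Ω) : ℝ≥0∞ :=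
  eLpNorm (fun x => W0.val φ x - W0.val ψ x) 1 (volume.restrict Ω)

/-- Paths `γ` on `[0,∞)` with values in `W^{1,2}_0(Ω)`, continuous in the strong topology of
`L¹(Ω)`, with `γ(0) = w` and `γ(t) → -w` in `L¹(Ω)` as `t → ∞`. -/
def l1Paths {N : ℕ} {Ω : Set (EuclideanSpace ℝ (Fin N))} (w : W0 Ω) : Set (ℝ≥0 → W0 Ω) :=
  {γ | (∀ t : ℝ≥0, Tendsto (fun s => l1Dist (γ s) (γ t)) (𝓝 t) (𝓝 0)) ∧ γ 0 = w ∧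
    Tendsto (fun t => l1Dist (γ t) (-w)) atTop (𝓝 0)}

/-- The level `ν^*_∞`; the supremum along a single path may be `+∞`. -/
def l1MountainPassLevel {N : ℕ} {Ω : Set (EuclideanSpace ℝ (Fin N))} (q α : ℝ) (w : W0 Ω) :
    EReal :=
  ⨅ γ ∈ l1Paths w, ⨆ φ ∈ range γ, (energy q α φ : EReal)

end MountainPass

end

/-! A `W0`-continuous path, frozen at its endpoint, is an admissible `L¹` path, so only `Λ* ≤ ν*_∞`
needs work. There, an `L¹`-continuous path with energy at most `M` is replaced by finitely many
segments between its points. On a segment the gradient term is convex, and the concave term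
`-∫|u|^q` spoils convexity of the energy only by a defect that is small when the endpoints are
`L¹`-close and `L²`-bounded (`energy_smul_add_smul_le`). The `L²` bound on sublevel sets comes from
Poincaré's inequality and `q < 2` (`exists_norm_fst_sq_le_of_energy_le`). Connectedness of `[0,∞)`
chains the segments together below `M + ε`. -/

namespace MountainPass

/-! ### Pointwise inequalities for powers -/

/-- The graph of `t ↦ t ^ q` on `[0, ∞)` lies above its tangents. -/
theorem rpow_le_rpow_add_mul_sub {q : ℝ} (hq : 1 ≤ q) {a b : ℝ} (ha : 0 ≤ a) (hb : 0 ≤ b) :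
    a ^ q ≤ b ^ q + q * a ^ (q - 1) * (a - b) := by
  rcases ha.eq_or_lt with rfl | ha
  · have h0 : (0 : ℝ) ^ q = 0 := Real.zero_rpow (by linarith)
    rw [h0]
    rcases hq.eq_or_lt with rfl | hq
    · simp
    · rw [Real.zero_rpow (by linarith)]
      simpa using Real.rpow_nonneg hb q
  · have h1 : 1 + q * (b / a - 1) ≤ (1 + (b / a - 1)) ^ q :=
      one_add_mul_self_le_rpow_one_add (by linarith [div_nonneg hb ha.le]) hq
    rw [add_sub_cancel, Real.div_rpow hb ha.le, le_div_iff₀ (Real.rpow_pos_of_pos ha q)] at h1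
    have h2 : a ^ q = a ^ (q - 1) * a := by
      rw [Real.rpow_sub_one ha.ne', div_mul_cancel₀ _ ha.ne']
    have h3 : (1 + q * (b / a - 1)) * a ^ q = a ^ q - q * a ^ (q - 1) * (a - b) := by
      rw [h2]
      field_simp
      ring
    linarith

/-- Split at the `K` with `K ^ (q - 2) = η`: above it `|a| ^ q` is absorbed by `η * a ^ 2` since `q
< 2`; below it the tangent slope is at most `q * K ^ (q - 1)`. -/
theorem exists_abs_rpow_le {q : ℝ} (hq1 : 1 ≤ q) (hq2 : q < 2) {η : ℝ} (hη : 0 < η) :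
    ∃ C, 0 ≤ C ∧ ∀ a b : ℝ, |a| ^ q ≤ |b| ^ q + η * a ^ 2 + C * |a - b| := by
  set K : ℝ := η ^ (1 / (q - 2)) with hK
  have hK0 : 0 < K := Real.rpow_pos_of_pos hη _
  have hKη : K ^ (q - 2) = η := by
    rw [hK, ← Real.rpow_mul hη.le, one_div, inv_mul_cancel₀ (by linarith), Real.rpow_one]
  have hK1 : 0 ≤ K ^ (q - 1) := Real.rpow_nonneg hK0.le _
  refine ⟨q * K ^ (q - 1), by positivity, fun a b => ?_⟩
  have hb : 0 ≤ |b| ^ q := by positivity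
  rcases le_total |a| K with h | h
  · have h1 := rpow_le_rpow_add_mul_sub hq1 (abs_nonneg a) (abs_nonneg b)
    have h2 : |a| ^ (q - 1) ≤ K ^ (q - 1) :=
      Real.rpow_le_rpow (abs_nonneg a) h (by linarith)
    have h3 : q * |a| ^ (q - 1) * (|a| - |b|) ≤ q * K ^ (q - 1) * |a - b| :=
      (mul_le_mul_of_nonneg_left (abs_sub_abs_le_abs_sub a b) (by positivity)).trans
        (by gcongr)
    have h4 : 0 ≤ η * a ^ 2 := by positivity
    linarith
  · have ha : 0 < |a| := hK0.trans_le h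
    have h1 : |a| ^ q = |a| ^ (q - 2) * a ^ 2 := by
      rw [← sq_abs a, ← Real.rpow_natCast |a| 2, ← Real.rpow_add ha]
      norm_num
    have h2 : |a| ^ (q - 2) ≤ η := by
      rw [← hKη]
      exact Real.rpow_le_rpow_of_nonpos hK0 h (by linarith)
    have h3 : |a| ^ (q - 2) * a ^ 2 ≤ η * a ^ 2 := by gcongr
    have h4 : 0 ≤ q * K ^ (q - 1) * |a - b| := by positivity
    linarith

theorem norm_sq_eq_integral_norm_sq {X E : Type*} [MeasurableSpace X] {μ : Measure X}
    [NormedAddCommGroup E] [InnerProductSpace ℝ E] (f : Lp E 2 μ) :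
    ‖f‖ ^ 2 = ∫ x, ‖f x‖ ^ 2 ∂μ := by
  rw [← real_inner_self_eq_norm_sq, L2.inner_def]
  simp only [real_inner_self_eq_norm_sq]

/-! ### Poincaré's inequality -/

variable {N : ℕ} {Ω : Set (EuclideanSpace ℝ (Fin N))}

/-- Poincaré's inequality for test functions. -/
theorem IsTestFunction.integral_sq_le {f : EuclideanSpace ℝ (Fin N) → ℝ}
    (hf : IsTestFunction Ω f) (hN : 0 < N) {R : ℝ} (hR : ∀ x ∈ Ω, ‖x‖ ≤ R) :
    ∫ x, f x ^ 2 ≤ 4 * R ^ 2 * ∫ x, ‖gradient f x‖ ^ 2 := by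
  obtain ⟨hf1, hf2, hf3⟩ := hf
  set v : EuclideanSpace ℝ (Fin N) := EuclideanSpace.single ⟨0, hN⟩ 1 with hv
  have hv1 : ‖v‖ = 1 := by simp [hv]
  have hfd : Differentiable ℝ f := hf1.differentiable (by simp)
  have hfc : Continuous f := hf1.continuous
  have hdc : Continuous (fderiv ℝ f) := hf1.continuous_fderiv (by simp)
  have hgc : Continuous (gradient f) := (LinearIsometryEquiv.continuous _).comp hdc
  have hds : HasCompactSupport (fderiv ℝ f) := hf2.fderiv ℝ
  have hsqs : HasCompactSupport (fun x => f x ^ 2) :=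
    hf2.comp_left (g := fun t : ℝ => t ^ 2) (by simp)
  have hsq : Integrable (fun x => f x ^ 2) :=
    (hfc.pow 2).integrable_of_hasCompactSupport hsqs
  have hgs : HasCompactSupport (fun x => ‖gradient f x‖ ^ 2) := by
    refine hds.comp_left (g := fun l => ‖(InnerProductSpace.toDual ℝ
      (EuclideanSpace ℝ (Fin N))).symm l‖ ^ 2) (by simp)
  have hg : Integrable (fun x => ‖gradient f x‖ ^ 2) :=
    (hgc.norm.pow 2).integrable_of_hasCompactSupport hgs
  have hlin (x : EuclideanSpace ℝ (Fin N)) : fderiv ℝ (fun y => inner ℝ v y) x v = 1 := by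
    have : fderiv ℝ (fun y => inner ℝ v y) x = innerSL ℝ v := (innerSL ℝ v).fderiv
    rw [this, innerSL_apply_apply, real_inner_self_eq_norm_sq, hv1, one_pow]
  have hsqd (x : EuclideanSpace ℝ (Fin N)) :
      fderiv ℝ (fun y => f y ^ 2) x v = 2 * f x * fderiv ℝ f x v := by
    rw [((hfd x).hasFDerivAt.pow 2).fderiv]
    simp
  have hprod : Integrable (fun x => inner ℝ v x * (2 * f x * fderiv ℝ f x v)) := by
    refine Continuous.integrable_of_hasCompactSupport (by fun_prop) ?_
    exact ((hf2.mul_left (f := fun _ => (2 : ℝ))).mul_right).mul_left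
  -- Since `⟨v, x⟩` has derivative `1` along `v`, integration by parts turns `∫ f²` into `-∫ ⟨v, x⟩
  -- ∂ᵥ(f²)`.
  have hibp : ∫ x, inner ℝ v x * fderiv ℝ (fun y => f y ^ 2) x v
      = - ∫ x, fderiv ℝ (fun y => inner ℝ v y) x v * f x ^ 2 := by
    refine integral_mul_fderiv_eq_neg_fderiv_mul_of_integrable ?_ ?_ ?_ ?_ ?_
    · simpa only [hlin, one_mul] using hsq
    · simpa only [hsqd] using hprod
    · exact Continuous.integrable_of_hasCompactSupport (by fun_prop) hsqs.mul_left
    · intro x _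
      exact (innerSL ℝ v).differentiableAt
    · intro x _
      exact (hfd x).pow 2
  simp only [hlin, hsqd, one_mul] at hibp
  -- Young's inequality weighted so that half of `∫ f²` is absorbed on the left, which yields the
  -- constant `4 * R ^ 2`.
  have hle : -∫ x, inner ℝ v x * (2 * f x * fderiv ℝ f x v)
      ≤ ∫ x, ((1 / 2) * f x ^ 2 + 2 * R ^ 2 * ‖gradient f x‖ ^ 2) := by
    rw [← integral_neg]
    refine integral_mono hprod.neg ((hsq.const_mul _).add (hg.const_mul _)) fun x => ?_
    show -(inner ℝ v x * (2 * f x * fderiv ℝ f x v)) ≤ _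
    by_cases hx : x ∈ Ω
    · have h1 : |inner ℝ v x * fderiv ℝ f x v| ≤ R * ‖gradient f x‖ := by
        rw [abs_mul, ← inner_gradient_left]
        refine mul_le_mul ?_ ?_ (abs_nonneg _) ((norm_nonneg _).trans (hR x hx))
        · simpa [hv1] using (abs_real_inner_le_norm v x).trans (by simpa [hv1] using hR x hx)
        · simpa [hv1] using abs_real_inner_le_norm (gradient f x) v
      have h2 : (inner ℝ v x * fderiv ℝ f x v) ^ 2 ≤ (R * ‖gradient f x‖) ^ 2 :=
        sq_le_sq' (abs_le.1 h1).1 (abs_le.1 h1).2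
      nlinarith [sq_nonneg (f x + 2 * (inner ℝ v x * fderiv ℝ f x v))]
    · have h0 : f x = 0 := image_eq_zero_of_notMem_tsupport fun h => hx (hf3 h)
      rw [h0]
      simp only [mul_zero, zero_mul, neg_zero]
      positivity
  rw [integral_add (hsq.const_mul _) (hg.const_mul _), integral_const_mul, integral_const_mul,
    hibp, neg_neg] at hle
  linarith

/-- Poincaré's inequality on `W^{1,2}_0(Ω)`. -/
theorem W0.norm_fst_sq_le (hN : 0 < N) {R : ℝ} (hR : ∀ x ∈ Ω, ‖x‖ ≤ R) (φ : W0 Ω) :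
    ‖φ.1.1‖ ^ 2 ≤ 4 * R ^ 2 * ‖φ.1.2‖ ^ 2 := by
  obtain ⟨p, hp⟩ := φ
  -- The inequality is a closed condition, so it passes from test functions to the closure.
  have hclosed : IsClosed {p : Lp ℝ 2 (volume.restrict Ω) ×
      Lp (EuclideanSpace ℝ (Fin N)) 2 (volume.restrict Ω) |
      ‖p.1‖ ^ 2 ≤ 4 * R ^ 2 * ‖p.2‖ ^ 2} :=
    isClosed_le (by fun_prop) (by fun_prop)
  refine closure_minimal (s := (testGraph Ω : Set (Lp ℝ 2 (volume.restrict Ω) ×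
    Lp (EuclideanSpace ℝ (Fin N)) 2 (volume.restrict Ω)))) ?_ hclosed hp
  rintro p ⟨f, hf, h1, h2⟩
  have hz (x) (hx : x ∉ Ω) : x ∉ tsupport f := fun h => hx (hf.2.2 h)
  show ‖p.1‖ ^ 2 ≤ 4 * R ^ 2 * ‖p.2‖ ^ 2
  rw [norm_sq_eq_integral_norm_sq, norm_sq_eq_integral_norm_sq]
  have e1 : ∫ x in Ω, ‖p.1 x‖ ^ 2 = ∫ x, f x ^ 2 := by
    rw [← setIntegral_eq_integral_of_forall_compl_eq_zero (s := Ω) (f := fun x => f x ^ 2)]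
    · refine integral_congr_ae (h1.mono fun x hx => ?_)
      simp [hx]
    · intro x hx
      simp [image_eq_zero_of_notMem_tsupport (hz x hx)]
  have e2 : ∫ x in Ω, ‖p.2 x‖ ^ 2 = ∫ x, ‖gradient f x‖ ^ 2 := by
    rw [← setIntegral_eq_integral_of_forall_compl_eq_zero (s := Ω)
      (f := fun x => ‖gradient f x‖ ^ 2)]
    · refine integral_congr_ae (h2.mono fun x hx => ?_)
      simp [hx]
    · intro x hx
      have : fderiv ℝ f x = 0 :=
        image_eq_zero_of_notMem_tsupport fun h => hz x hx (tsupport_fderiv_subset ℝ h)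
      simp [gradient, this]
  rw [e1, e2]
  exact hf.integral_sq_le hN hR

/-! ### The functional `∫ |u| ^ q` on a finite measure space -/

section FiniteMeasure

variable {X : Type*} [MeasurableSpace X] {μ : Measure X} [IsFiniteMeasure μ]

theorem integrable_abs_rpow {q : ℝ} (hq1 : 1 < q) (hq2 : q < 2) (u : Lp ℝ 2 μ) :
    Integrable (fun x => |u x| ^ q) μ := by
  have h : MemLp u (ENNReal.ofReal q) μ :=
    (Lp.memLp u).mono_exponent (by
      rw [← ENNReal.ofReal_ofNat 2]
      exact ENNReal.ofReal_le_ofReal hq2.le)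
  have h0 : ENNReal.ofReal q ≠ 0 := by simp; linarith
  simpa [ENNReal.toReal_ofReal (zero_le_one.trans hq1.le)]
    using h.integrable_norm_rpow h0 ENNReal.ofReal_ne_top

theorem integral_abs_rpow_le_add {q : ℝ} (hq1 : 1 < q) (hq2 : q < 2) {η C : ℝ}
    (h : ∀ a b : ℝ, |a| ^ q ≤ |b| ^ q + η * a ^ 2 + C * |a - b|) (u v : Lp ℝ 2 μ) :
    ∫ x, |u x| ^ q ∂μ ≤
      ∫ x, |v x| ^ q ∂μ + η * ‖u‖ ^ 2 + C * ∫ x, |u x - v x| ∂μ := by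
  have hu2 : Integrable (fun x => u x ^ 2) μ := (Lp.memLp u).integrable_sq
  have huv : Integrable (fun x => |u x - v x|) μ :=
    (((Lp.memLp u).integrable one_le_two).sub ((Lp.memLp v).integrable one_le_two)).abs
  have hv := integrable_abs_rpow hq1 hq2 v
  have key := integral_mono (integrable_abs_rpow hq1 hq2 u)
    ((hv.add (hu2.const_mul η)).add (huv.const_mul C)) fun x => h (u x) (v x)
  rw [integral_add' (hv.add (hu2.const_mul η)) (huv.const_mul C),
    integral_add' hv (hu2.const_mul η), integral_const_mul, integral_const_mul] at key
  rw [norm_sq_eq_integral_norm_sq]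
  simpa using key

/-- A quantitative continuity estimate for the convex functional `∫ |u| ^ q` on a segment. -/
theorem integral_abs_rpow_convex_defect_le {q : ℝ} (hq1 : 1 < q) (hq2 : q < 2) {η C : ℝ}
    (hη : 0 ≤ η) (hC0 : 0 ≤ C)
    (hC : ∀ a b : ℝ, |a| ^ q ≤ |b| ^ q + η * a ^ 2 + C * |a - b|) (u v : Lp ℝ 2 μ)
    {a b : ℝ} (ha : 0 ≤ a) (hb : 0 ≤ b) (hab : a + b = 1) :
    a * ∫ x, |u x| ^ q ∂μ + b * ∫ x, |v x| ^ q ∂μ - ∫ x, |(a • u + b • v : Lp ℝ 2 μ) x| ^ q ∂μ ≤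
      η * (‖u‖ ^ 2 + ‖v‖ ^ 2) + C * ∫ x, |u x - v x| ∂μ := by
  obtain ⟨θ, hθ⟩ : ∃ θ : Lp ℝ 2 μ, θ = a • u + b • v := ⟨_, rfl⟩
  rw [← hθ]
  have hv : ∀ᵐ x ∂μ, θ x = a * u x + b * v x := by
    rw [hθ]
    filter_upwards [Lp.coeFn_add (a • u) (b • v), Lp.coeFn_smul a u,
      Lp.coeFn_smul b v] with x h1 h2 h3
    rw [h1, Pi.add_apply, h2, h3, Pi.smul_apply, Pi.smul_apply, smul_eq_mul, smul_eq_mul]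
  obtain rfl : b = 1 - a := by linarith
  have huθ : ∫ x, |u x - θ x| ∂μ = (1 - a) * ∫ x, |u x - v x| ∂μ := by
    rw [← integral_const_mul]
    refine integral_congr_ae (hv.mono fun x hx => ?_)
    dsimp only
    rw [hx, show u x - (a * u x + (1 - a) * v x) = (1 - a) * (u x - v x) by ring, abs_mul,
      abs_of_nonneg hb]
  have hvθ : ∫ x, |v x - θ x| ∂μ = a * ∫ x, |u x - v x| ∂μ := by
    rw [← integral_const_mul]
    refine integral_congr_ae (hv.mono fun x hx => ?_)
    dsimp only
    rw [hx, show v x - (a * u x + (1 - a) * v x) = a * (v x - u x) by ring, abs_mul,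
      abs_of_nonneg ha, abs_sub_comm]
  have h1 := integral_abs_rpow_le_add hq1 hq2 hC u θ
  have h2 := integral_abs_rpow_le_add hq1 hq2 hC v θ
  rw [huθ] at h1
  rw [hvθ] at h2
  have hCL : 0 ≤ C * ∫ x, |u x - v x| ∂μ :=
    mul_nonneg hC0 (integral_nonneg fun x => abs_nonneg _)
  have s1 : a * (η * ‖u‖ ^ 2) ≤ η * ‖u‖ ^ 2 :=
    mul_le_of_le_one_left (by positivity) (by linarith)
  have s2 : (1 - a) * (η * ‖v‖ ^ 2) ≤ η * ‖v‖ ^ 2 :=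
    mul_le_of_le_one_left (by positivity) (by linarith)
  -- The distances from `u` and `v` to `θ`, averaged with weights `a` and `1 - a`, give the factor
  -- `2a(1 - a) ≤ 1`.
  have s3 : 2 * (a * (1 - a)) * (C * ∫ x, |u x - v x| ∂μ) ≤ C * ∫ x, |u x - v x| ∂μ :=
    mul_le_of_le_one_left hCL (by nlinarith [sq_nonneg (a - 1 / 2)])
  have t1 := mul_le_mul_of_nonneg_left h1 ha
  have t2 := mul_le_mul_of_nonneg_left h2 hb
  linarith

/-- Subcritical growth: `∫ |u| ^ q` is controlled by an arbitrarily small multiple of `‖u‖²`. -/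
theorem exists_integral_abs_rpow_le {q : ℝ} (hq1 : 1 < q) (hq2 : q < 2) {η : ℝ} (hη : 0 < η) :
    ∃ D, ∀ u : Lp ℝ 2 μ, ∫ x, |u x| ^ q ∂μ ≤ η * ‖u‖ ^ 2 + D := by
  obtain ⟨C, -, hC⟩ := exists_abs_rpow_le hq1.le hq2 (half_pos hη)
  refine ⟨C ^ 2 / (2 * η) * μ.real univ, fun u => ?_⟩
  have hu2 : Integrable (fun x => u x ^ 2) μ := (Lp.memLp u).integrable_sq
  have hpt (a : ℝ) : |a| ^ q ≤ η * a ^ 2 + C ^ 2 / (2 * η) := by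
    have h1 := hC a 0
    rw [abs_zero, Real.zero_rpow (by linarith), sub_zero] at h1
    have h2 : C * |a| ≤ η / 2 * a ^ 2 + C ^ 2 / (2 * η) := by
      rw [← sub_nonneg, ← sq_abs a]
      have : η / 2 * |a| ^ 2 + C ^ 2 / (2 * η) - C * |a| = (η * |a| - C) ^ 2 / (2 * η) := by
        field_simp
        ring
      rw [this]
      positivity
    linarith
  have key := integral_mono (integrable_abs_rpow hq1 hq2 u)
    ((hu2.const_mul η).add (integrable_const (C ^ 2 / (2 * η)))) fun x => hpt (u x)
  rw [integral_add' (hu2.const_mul η) (integrable_const _), integral_const_mul,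
    integral_const] at key
  rw [norm_sq_eq_integral_norm_sq]
  simpa [mul_comm] using key

end FiniteMeasure

/-! ### The energy on sublevel sets and segments -/

theorem isFiniteMeasure_restrict_of_isBounded (hΩ : Bornology.IsBounded Ω) :
    IsFiniteMeasure ((volume : Measure (EuclideanSpace ℝ (Fin N))).restrict Ω) :=
  isFiniteMeasure_restrict.2 hΩ.measure_lt_top.ne

theorem energy_eq (q α : ℝ) (φ : W0 Ω) :
    energy q α φ = 1 / 2 * ‖φ.1.2‖ ^ 2 - α / q * ∫ x in Ω, |φ.1.1 x| ^ q := by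
  rw [norm_sq_eq_integral_norm_sq]
  rfl

theorem energy_neg (q α : ℝ) (φ : W0 Ω) : energy q α (-φ) = energy q α φ := by
  have h : ∫ x in Ω, |(-φ).1.1 x| ^ q = ∫ x in Ω, |φ.1.1 x| ^ q := by
    refine integral_congr_ae ((Lp.coeFn_neg φ.1.1).mono fun x hx => ?_)
    have hx' : (-φ).1.1 x = -(φ.1.1 x) := hx
    simp only [hx', abs_neg]
  have h2 : ‖(-φ).1.2‖ = ‖φ.1.2‖ := norm_neg φ.1.2
  rw [energy_eq, energy_eq, h, h2]

/-- Sublevel sets of the energy are bounded in `L²(Ω)`. -/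
theorem exists_norm_fst_sq_le_of_energy_le (hN : 0 < N) (hΩ : Bornology.IsBounded Ω) {q α : ℝ}
    (hq1 : 1 < q) (hq2 : q < 2) (hα : 0 < α) (M : ℝ) :
    ∃ K, ∀ φ : W0 Ω, energy q α φ ≤ M → ‖φ.1.1‖ ^ 2 ≤ K := by
  have := isFiniteMeasure_restrict_of_isBounded hΩ
  obtain ⟨R, hR⟩ := hΩ.exists_norm_le
  have hq0 : 0 < q := by linarith
  set P : ℝ := 4 * R ^ 2 with hP
  have hP0 : 0 ≤ P := by positivity
  -- With Poincaré's constant `P`, this makes the power term cost at most a quarter of `‖∇φ‖²`, plus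
  -- a constant; `P + 1` avoids dividing by zero.
  set η : ℝ := q / (4 * α * (P + 1)) with hη
  have hη0 : 0 < η := by positivity
  obtain ⟨D, hD⟩ := exists_integral_abs_rpow_le (μ := volume.restrict Ω) hq1 hq2 hη0
  refine ⟨P * (4 * (M + α / q * D)), fun φ hφ => ?_⟩
  have h1 := W0.norm_fst_sq_le hN hR φ
  rw [energy_eq] at hφ
  have h2 : α / q * ∫ x in Ω, |φ.1.1 x| ^ q ≤ α / q * (η * ‖φ.1.1‖ ^ 2 + D) :=
    mul_le_mul_of_nonneg_left (hD φ.1.1) (by positivity)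
  have h3 : α / q * (η * ‖φ.1.1‖ ^ 2) ≤ 1 / 4 * ‖φ.1.2‖ ^ 2 := by
    have e : α / q * (η * ‖φ.1.1‖ ^ 2) = 1 / 4 * (‖φ.1.1‖ ^ 2 / (P + 1)) := by
      rw [hη]
      field_simp
    rw [e]
    gcongr
    rw [div_le_iff₀ (by positivity)]
    nlinarith [sq_nonneg ‖φ.1.2‖]
  refine h1.trans (mul_le_mul_of_nonneg_left ?_ hP0)
  linarith

theorem norm_smul_add_smul_sq_le {E : Type*} [SeminormedAddCommGroup E] [NormedSpace ℝ E]
    (x y : E) {a b : ℝ} (ha : 0 ≤ a) (hb : 0 ≤ b) (hab : a + b = 1) :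
    ‖a • x + b • y‖ ^ 2 ≤ a * ‖x‖ ^ 2 + b * ‖y‖ ^ 2 := by
  have h := (convexOn_univ_norm (E := E)).pow (fun _ _ => norm_nonneg _) 2
  simpa using h.2 (mem_univ x) (mem_univ y) ha hb hab

theorem l1Dist_eq_ofReal (hΩ : Bornology.IsBounded Ω) (φ ψ : W0 Ω) :
    l1Dist φ ψ = ENNReal.ofReal (∫ x in Ω, |φ.1.1 x - ψ.1.1 x|) := by
  have := isFiniteMeasure_restrict_of_isBounded hΩ
  have h : Integrable (fun x => φ.1.1 x - ψ.1.1 x) (volume.restrict Ω) :=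
    ((Lp.memLp φ.1.1).integrable one_le_two).sub ((Lp.memLp ψ.1.1).integrable one_le_two)
  rw [l1Dist, eLpNorm_one_eq_lintegral_enorm]
  exact (ofReal_integral_norm_eq_lintegral_enorm h).symm

/-- Along the segment between two points the energy exceeds a common bound by at most a quantity
controlled by `L²` norms and the `L¹` distance. -/
theorem energy_smul_add_smul_le (hΩ : Bornology.IsBounded Ω) {q α : ℝ}
    (hq1 : 1 < q) (hq2 : q < 2) (hα : 0 < α) {η C M : ℝ} (hη : 0 ≤ η) (hC0 : 0 ≤ C)
    (hC : ∀ a b : ℝ, |a| ^ q ≤ |b| ^ q + η * a ^ 2 + C * |a - b|)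
    {φ ψ : W0 Ω} (hφ : energy q α φ ≤ M) (hψ : energy q α ψ ≤ M)
    {a b : ℝ} (ha : 0 ≤ a) (hb : 0 ≤ b) (hab : a + b = 1) :
    energy q α (a • φ + b • ψ) ≤ M + α / q * (η * (‖φ.1.1‖ ^ 2 + ‖ψ.1.1‖ ^ 2) +
      C * ∫ x in Ω, |φ.1.1 x - ψ.1.1 x|) := by
  have := isFiniteMeasure_restrict_of_isBounded hΩ
  have hq0 : 0 < q := by linarith
  have hB := integral_abs_rpow_convex_defect_le hq1 hq2 hη hC0 hC φ.1.1 ψ.1.1 ha hb hab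
  have hg := norm_smul_add_smul_sq_le φ.1.2 ψ.1.2 ha hb hab
  have hθ : energy q α (a • φ + b • ψ) = 1 / 2 * ‖a • φ.1.2 + b • ψ.1.2‖ ^ 2 -
      α / q * ∫ x in Ω, |(a • φ.1.1 + b • ψ.1.1 : Lp ℝ 2 (volume.restrict Ω)) x| ^ q :=
    energy_eq q α (a • φ + b • ψ)
  rw [hθ]
  rw [energy_eq] at hφ hψ
  have hαq : 0 ≤ α / q := by positivity
  have t := mul_le_mul_of_nonneg_left hB hαq
  have u1 := mul_le_mul_of_nonneg_left hφ ha
  have u2 := mul_le_mul_of_nonneg_left hψ hb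
  have u3 : a * M + b * M = M := by rw [← add_mul, hab, one_mul]
  linarith

/-- `L¹`-close points of a sublevel set are joined by a segment in a slightly larger one. -/
theorem exists_joinedIn_of_l1Dist_lt (hN : 0 < N) (hΩ : Bornology.IsBounded Ω) {q α : ℝ}
    (hq1 : 1 < q) (hq2 : q < 2) (hα : 0 < α) (M : ℝ) {ε : ℝ} (hε : 0 < ε) :
    ∃ δ : ℝ≥0∞, 0 < δ ∧ ∀ φ ψ : W0 Ω, energy q α φ ≤ M → energy q α ψ ≤ M → l1Dist φ ψ < δ →
      JoinedIn {θ : W0 Ω | energy q α θ ≤ M + ε} φ ψ := by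
  have hq0 : 0 < q := by linarith
  obtain ⟨K, hK⟩ := exists_norm_fst_sq_le_of_energy_le (Ω := Ω) hN hΩ hq1 hq2 hα M
  -- `ρ` is the defect allowed before the factor `α / q`; `η` spends half of it on the `L²` norms
  -- and `δ` the other half on the `L¹` distance.
  set ρ : ℝ := q / α * ε with hρ
  have hρ0 : 0 < ρ := by positivity
  set η : ℝ := ρ / (4 * (|K| + 1)) with hη
  have hη0 : 0 < η := by positivity
  obtain ⟨C, hC0, hC⟩ := exists_abs_rpow_le hq1.le hq2 hη0
  refine ⟨ENNReal.ofReal (ρ / (2 * (C + 1))), by simp; positivity, fun φ ψ hφ hψ hd => ?_⟩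
  rw [l1Dist_eq_ofReal hΩ, ENNReal.ofReal_lt_ofReal_iff (by positivity)] at hd
  refine JoinedIn.of_segment_subset ?_
  rintro _ ⟨a, b, ha, hb, hab, rfl⟩
  refine (energy_smul_add_smul_le hΩ hq1 hq2 hα hη0.le hC0 hC hφ hψ ha hb hab).trans ?_
  have h1 : η * (‖φ.1.1‖ ^ 2 + ‖ψ.1.1‖ ^ 2) ≤ ρ / 2 := by
    have : ‖φ.1.1‖ ^ 2 + ‖ψ.1.1‖ ^ 2 ≤ 2 * (|K| + 1) := by
      linarith [hK φ hφ, hK ψ hψ, le_abs_self K]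
    refine (mul_le_mul_of_nonneg_left this hη0.le).trans_eq ?_
    rw [hη]
    field_simp
    norm_num
  have h2 : C * ∫ x in Ω, |φ.1.1 x - ψ.1.1 x| ≤ ρ / 2 := by
    have : C * (ρ / (2 * (C + 1))) ≤ ρ / 2 := by
      rw [mul_div_assoc', div_le_div_iff₀ (by positivity) (by positivity)]
      nlinarith
    exact (mul_le_mul_of_nonneg_left hd.le hC0).trans this
  have h3 : α / q * ρ = ε := by
    rw [hρ]
    field_simp
  have h4 := mul_le_mul_of_nonneg_left (add_le_add h1 h2) (show 0 ≤ α / q by positivity)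
  rw [add_halves, h3] at h4
  linarith

/-! ### Comparison of the two levels -/

theorem tendsto_l1Dist_nhds (hΩ : Bornology.IsBounded Ω) (φ : W0 Ω) :
    Tendsto (fun ψ => l1Dist ψ φ) (𝓝 φ) (𝓝 0) := by
  have := isFiniteMeasure_restrict_of_isBounded hΩ
  set c : ℝ≥0∞ := volume.restrict Ω univ ^ (1 / (1 : ℝ≥0∞).toReal - 1 / (2 : ℝ≥0∞).toReal) with hc
  have hle (ψ : W0 Ω) : l1Dist ψ φ ≤ ‖ψ.1.1 - φ.1.1‖ₑ * c := by
    have h := eLpNorm_le_eLpNorm_mul_rpow_measure_univ (p := 1) (q := 2) one_le_two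
      (Lp.aestronglyMeasurable (ψ.1.1 - φ.1.1))
    rw [← Lp.enorm_def] at h
    refine le_trans (le_of_eq ?_) h
    refine eLpNorm_congr_ae ?_
    filter_upwards [Lp.coeFn_sub ψ.1.1 φ.1.1] with x hx
    rw [hx]
    rfl
  have hct : c ≠ ⊤ := by
    rw [hc]
    exact ENNReal.rpow_ne_top_of_nonneg (by norm_num) (measure_ne_top _ _)
  have hlim : Tendsto (fun ψ : W0 Ω => ‖ψ.1.1 - φ.1.1‖ₑ * c) (𝓝 φ) (𝓝 0) := by
    have h1 : Tendsto (fun ψ : W0 Ω => ‖ψ.1.1 - φ.1.1‖ₑ) (𝓝 φ) (𝓝 0) := by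
      have h2 : Continuous (fun ψ : W0 Ω => ‖ψ.1.1 - φ.1.1‖ₑ) := by fun_prop
      simpa using h2.tendsto φ
    simpa using ENNReal.Tendsto.mul_const (b := c) h1 (Or.inr hct)
  exact tendsto_of_tendsto_of_tendsto_of_le_of_le tendsto_const_nhds hlim (fun _ => zero_le) hle

theorem l1MountainPassLevel_le_mountainPassLevel (hΩ : Bornology.IsBounded Ω) (q α : ℝ)
    (w : W0 Ω) : l1MountainPassLevel q α w ≤ mountainPassLevel q α w := by
  refine le_iInf₂ fun γ hγ => ?_
  set p : ℝ≥0 → W0 Ω := fun t => γ (projIcc 0 1 zero_le_one (t : ℝ)) with hp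
  have hpc : Continuous p := γ.continuous.comp (continuous_projIcc.comp NNReal.continuous_coe)
  have hmem : p ∈ l1Paths w := by
    refine ⟨fun t => (tendsto_l1Dist_nhds hΩ (p t)).comp (hpc.tendsto t), ?_, ?_⟩
    · simp only [hp, NNReal.coe_zero, projIcc_left]
      exact hγ.1
    · refine tendsto_const_nhds.congr' ?_
      filter_upwards [eventually_ge_atTop 1] with t ht
      have h1 : p t = -w := by
        simp only [hp]
        rw [projIcc_of_right_le _ (by exact_mod_cast ht)]
        exact hγ.2
      rw [h1]
      simp [l1Dist]
  refine (iInf₂_le p hmem).trans (iSup₂_le ?_)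
  rintro _ ⟨t, rfl⟩
  exact le_iSup₂ (f := fun φ (_ : φ ∈ range γ) => (energy q α φ : EReal)) _ (mem_range_self _)

theorem mountainPassLevel_le_of_joinedIn {q α : ℝ} {w : W0 Ω} {c : ℝ}
    (h : JoinedIn {θ : W0 Ω | energy q α θ ≤ c} w (-w)) : mountainPassLevel q α w ≤ c := by
  obtain ⟨p, hp⟩ := h
  refine (iInf₂_le p.toContinuousMap ⟨p.source, p.target⟩).trans (iSup₂_le ?_)
  rintro _ ⟨t, rfl⟩
  exact EReal.coe_le_coe_iff.2 (hp t)

/-- Nearby times give `L¹`-close points, hence joined ones, and joinedness is transitive, so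
connectedness of `[0,∞)` reaches any time `T`. For suitable `T` a last segment ends at `-w`, which
is in the sublevel set because the energy is even. -/
theorem joinedIn_of_mem_l1Paths (hN : 0 < N) (hΩ : Bornology.IsBounded Ω) {q α : ℝ}
    (hq1 : 1 < q) (hq2 : q < 2) (hα : 0 < α) {w : W0 Ω} {γ : ℝ≥0 → W0 Ω} (hγ : γ ∈ l1Paths w)
    {M : ℝ} (hM : ∀ t, energy q α (γ t) ≤ M) {ε : ℝ} (hε : 0 < ε) :
    JoinedIn {θ : W0 Ω | energy q α θ ≤ M + ε} w (-w) := by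
  obtain ⟨δ, hδ, hjoin⟩ := exists_joinedIn_of_l1Dist_lt (Ω := Ω) hN hΩ hq1 hq2 hα M hε
  obtain ⟨hc, h0, hlim⟩ := hγ
  have hw : energy q α (-w) ≤ M := by
    rw [energy_neg, ← h0]
    exact hM 0
  obtain ⟨T, hT⟩ := (hlim.eventually_lt_const hδ).exists
  have hpath : JoinedIn {θ : W0 Ω | energy q α θ ≤ M + ε} (γ 0) (γ T) := by
    refine PreconnectedSpace.induction₂'
      (fun s t : ℝ≥0 => JoinedIn {θ : W0 Ω | energy q α θ ≤ M + ε} (γ s) (γ t)) (fun t => ?_)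
      ⟨fun _ _ _ h1 h2 => h1.trans h2⟩ 0 T
    filter_upwards [(hc t).eventually_lt_const hδ] with s hs
    have := hjoin _ _ (hM s) (hM t) hs
    exact ⟨this.symm, this⟩
  rw [h0] at hpath
  exact hpath.trans (hjoin _ _ (hM T) hw hT)

theorem mountainPassLevel_le_l1MountainPassLevel (hN : 0 < N) (hΩ : Bornology.IsBounded Ω)
    {q α : ℝ} (hq1 : 1 < q) (hq2 : q < 2) (hα : 0 < α) (w : W0 Ω) :
    mountainPassLevel q α w ≤ l1MountainPassLevel q α w := by
  refine le_iInf₂ fun γ hγ => ?_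
  -- Testing against real `c` above the supremum makes an infinite supremum vacuous; an intermediate
  -- `M` leaves room for `ε = c - M`.
  refine EReal.le_of_forall_lt_iff_le.1 fun c hc => ?_
  obtain ⟨M, hM, hMc⟩ := EReal.lt_iff_exists_real_btwn.1 hc
  have hMc' : M < c := EReal.coe_lt_coe_iff.1 hMc
  have hle (t : ℝ≥0) : energy q α (γ t) ≤ M := by
    refine EReal.coe_le_coe_iff.1 (le_trans ?_ hM.le)
    exact le_iSup₂ (f := fun φ (_ : φ ∈ range γ) => (energy q α φ : EReal)) _ (mem_range_self t)
  have h := joinedIn_of_mem_l1Paths hN hΩ hq1 hq2 hα hγ hle (sub_pos.2 hMc')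
  rw [add_sub_cancel] at h
  exact mountainPassLevel_le_of_joinedIn h

end MountainPass

theorem corollary4p3 {N : ℕ} (hN : 0 < N) (q α : ℝ) (hq1 : 1 < q) (hq2 : q < 2) (hα : 0 < α)
    (Ω : Set (EuclideanSpace ℝ (Fin N))) (hΩo : IsOpen Ω) (hΩb : Bornology.IsBounded Ω)
    (hΩc : IsConnected Ω)
    (w : MountainPass.W0 Ω) (hw : MountainPass.IsPositiveMinimizer q α w) :
    MountainPass.l1MountainPassLevel q α w = MountainPass.mountainPassLevel q α w :=
  le_antisymm (MountainPass.l1MountainPassLevel_le_mountainPassLevel hΩb q α w)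
    (MountainPass.mountainPassLevel_le_l1MountainPassLevel hN hΩb hq1 hq2 hα w)
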